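/- Let $A$ be a (not necessarily unital) C*-algebra. Suppose that $A$ almost has stable rank one, meaning that for every closed hereditary C*-subalgebra $B\subseteq A$ every element of $B$ is a norm limit of invertible elements of the unitization $B^\sim$. Let $a,b\in A$ be positive elements. Write $a\precsim b$ if there is a sequence $(d_n)$ in $A$ with $d_n^*bd_n\to a$ in norm, and $a\sim b$ if $a\precsim b$ and $b\precsim a$. Regard the closed right ideals $\overline{aA}$ and $\overline{bA}$ as right Hilbert C*-modules over $A$ with inner product $\langle x,y\rangle=x^*y$. Then: 1. $a\precsim b$ if and only if $\overline{aA}$ embeds in $\overline{bA}$ as a right Hilbert $A$-module, that is, there is an $A$-linear map $\overline{aA}\to\overline{bA}$ preserving the $A$-valued inner products; 2. $a\sim b$ if and only if $\overline{aA}$ and $\overline{bA}$ are isomorphic as right Hilbert $A$-modules, that is, there is a bijective $A$-linear map $\overline{aA}\to\overline{bA}$ preserving the $A$-valued inner products. -/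

import Mathlib

open scoped RightActions

/-! ### Almost stable rank one -/

section AlmostStableRankOne

variable {A : Type*} [NonUnitalCStarAlgebra A] [PartialOrder A]

/-- `B` is a closed hereditary subalgebra of the C⋆-algebra `A`: a norm-closed ⋆-subalgebra
such that `0 ≤ x ≤ y` with `y ∈ B` forces `x ∈ B`. -/
structure IsClosedHereditary (B : NonUnitalStarSubalgebra ℂ A) : Prop where
  isClosed : IsClosed (B : Set A)
  hereditary : ∀ x y : A, 0 ≤ x → x ≤ y → y ∈ B → x ∈ B

variable (A) in
/-- `A` almost has stable rank one: for every closed hereditary subalgebra `B`, each element of `B`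
is a norm limit of invertible elements of the unitization `B~`. Here `B~` is the algebra
`ℂ ⊕ B`, where a new unit is adjoined even if `B` already has one; the closure is taken in the
product topology of `ℂ × B`, which is the topology of the C⋆-norm of `B~`. -/
def AlmostStableRankOne : Prop :=
  ∀ B : NonUnitalStarSubalgebra ℂ A, IsClosedHereditary B →
    ∀ x : B, (x : Unitization ℂ B) ∈ closure {u : Unitization ℂ B | IsUnit u}

end AlmostStableRankOne

/-! ### Cuntz comparison -/

section Cuntz

variable {A : Type*} [NonUnitalCStarAlgebra A]

/-- Cuntz comparison `a ≾ b` (used for positive `a`, `b`): `dₙ⋆ b dₙ → a` for some `dₙ ∈ A`. -/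
def CuntzBelow (a b : A) : Prop :=
  ∃ d : ℕ → A, Filter.Tendsto (fun n => star (d n) * b * d n) Filter.atTop (nhds a)

/-- Cuntz equivalence. -/
def CuntzEquiv (a b : A) : Prop := CuntzBelow a b ∧ CuntzBelow b a

end Cuntz

/-! ### Right Hilbert C⋆-modules -/

/-- A right Hilbert C⋆-module `E` over the C⋆-algebra `A`. The right action of `c : A` on `x : E`
is written `x <• c`; the `A`-valued inner product is linear in the second variable; the norm is the
one induced by the inner product, and `E` is complete for it. -/
class RightHilbertModule (A E : Type*) [NonUnitalCStarAlgebra A] [PartialOrder A]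
    [NormedAddCommGroup E] [NormedSpace ℂ E] [SMul Aᵐᵒᵖ E] where
  add_act (x y : E) (c : A) : (x + y) <• c = x <• c + y <• c
  act_add (x : E) (c d : A) : x <• (c + d) = x <• c + x <• d
  act_mul (x : E) (c d : A) : x <• (c * d) = (x <• c) <• d
  smul_act (z : ℂ) (x : E) (c : A) : (z • x) <• c = z • (x <• c)
  act_smul (z : ℂ) (x : E) (c : A) : x <• (z • c) = z • (x <• c)
  /-- The `A`-valued inner product. -/
  inner : E → E → A
  inner_add (x y z : E) : inner x (y + z) = inner x y + inner x z
  inner_smul (z : ℂ) (x y : E) : inner x (z • y) = z • inner x y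
  inner_act (x y : E) (c : A) : inner x (y <• c) = inner x y * c
  star_inner (x y : E) : star (inner x y) = inner y x
  inner_self_nonneg (x : E) : 0 ≤ inner x x
  inner_self_eq_zero (x : E) : inner x x = 0 → x = 0
  norm_sq_eq (x : E) : ‖x‖ ^ 2 = ‖inner x x‖
  complete : CompleteSpace E

section HilbertMaps

variable (A E F : Type*) [NonUnitalCStarAlgebra A] [PartialOrder A]
  [NormedAddCommGroup E] [NormedSpace ℂ E] [SMul Aᵐᵒᵖ E] [RightHilbertModule A E]
  [NormedAddCommGroup F] [NormedSpace ℂ F] [SMul Aᵐᵒᵖ F] [RightHilbertModule A F]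

/-- `E` embeds in `F` as a right Hilbert `A`-module: there is an `A`-linear map `E → F` preserving
the `A`-valued inner products (hence isometric, with closed range). -/
def HilbertEmbeds : Prop :=
  ∃ φ : E →ₗ[ℂ] F, (∀ (x : E) (c : A), φ (x <• c) = φ x <• c) ∧
    ∀ x y : E, RightHilbertModule.inner (A := A) (φ x) (φ y) = RightHilbertModule.inner x y

/-- `E` and `F` are isomorphic as right Hilbert `A`-modules: there is an `A`-linear bijection
`E → F` preserving the `A`-valued inner products. -/
def HilbertIso : Prop :=
  ∃ φ : E ≃ₗ[ℂ] F, (∀ (x : E) (c : A), φ (x <• c) = φ x <• c) ∧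
    ∀ x y : E, RightHilbertModule.inner (A := A) (φ x) (φ y) = RightHilbertModule.inner x y

end HilbertMaps

/-! ### The right Hilbert module `closure (aA)` -/

section ClosedRightIdeal

variable {A : Type*} [NonUnitalCStarAlgebra A]

/-- The closed right ideal `closure (aA)`. -/
def closedRightIdeal (a : A) : Submodule ℂ A :=
  (LinearMap.range (LinearMap.mulLeft ℂ a)).topologicalClosure

theorem coe_closedRightIdeal (a : A) :
    (closedRightIdeal a : Set A) = closure {y | ∃ x, y = a * x} := by
  simp only [closedRightIdeal, Submodule.topologicalClosure_coe]
  congr 1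
  ext y
  simp [eq_comm]

theorem mul_mem_closedRightIdeal (a : A) {x : A} (hx : x ∈ closedRightIdeal a) (c : A) :
    x * c ∈ closedRightIdeal a := by
  rw [← SetLike.mem_coe, coe_closedRightIdeal] at hx ⊢
  refine map_mem_closure (f := fun y => y * c) (by fun_prop) hx ?_
  rintro _ ⟨y, rfl⟩
  exact ⟨y * c, mul_assoc _ _ _⟩

/-- `A` acts on `closure (aA)` by right multiplication. -/
instance closedRightIdeal.instAct (a : A) : SMul Aᵐᵒᵖ (closedRightIdeal a) where
  smul c x := ⟨(x : A) * c.unop, mul_mem_closedRightIdeal a x.2 c.unop⟩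

theorem closedRightIdeal.coe_act (a : A) (x : closedRightIdeal a) (c : A) :
    ((x <• c : closedRightIdeal a) : A) = x * c := rfl

/-- `closure (aA)` is a right Hilbert `A`-module with inner product `⟨x, y⟩ = x⋆ y`; its norm is the
norm of `A`. -/
instance closedRightIdeal.instRightHilbertModule [PartialOrder A] [StarOrderedRing A] (a : A) :
    RightHilbertModule A (closedRightIdeal a) where
  add_act x y c := Subtype.ext (add_mul (x : A) y c)
  act_add x c d := Subtype.ext (mul_add (x : A) c d)
  act_mul x c d := Subtype.ext (mul_assoc (x : A) c d).symm
  smul_act z x c := Subtype.ext (smul_mul_assoc z (x : A) c)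
  act_smul z x c := Subtype.ext (mul_smul_comm z (x : A) c)
  inner x y := star (x : A) * y
  inner_add x y z := mul_add (star (x : A)) y z
  inner_smul z x y := mul_smul_comm z (star (x : A)) (y : A)
  inner_act x y c := (mul_assoc (star (x : A)) y c).symm
  star_inner x y := by simp
  inner_self_nonneg x := star_mul_self_nonneg (x : A)
  inner_self_eq_zero x h := Subtype.ext ((CStarRing.star_mul_self_eq_zero_iff (x : A)).1 h)
  norm_sq_eq x := by
    rw [CStarRing.norm_star_mul_self, sq]
    rfl
  complete := (Submodule.isClosed_topologicalClosure _).completeSpace_coe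

end ClosedRightIdeal

/-! An `A`-linear map from `closure (aA)` to `closure (bA)` that preserves inner products is
determined by the image `x` of `sqrt a`, and the possible `x` are the elements of `closure (bA)`
with `x⋆x = a` (`factorizations a b`). Approximating such an `x` by `sqrt b * dₙ` gives `a ≾ b`.

The stable rank hypothesis enters through one perturbation estimate, `exists_isometry_norm_sub_le`.
If `x, y` in `closure (bA)` satisfy `x⋆x ≈ y⋆y`, then `yx⋆` lies in the hereditary subalgebra of
`b`, so it is close to an invertible `g = u|g|`. Since `|yx⋆|² = xy⋆yx⋆ ≈ (xx⋆)²`, it follows that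
`yx⋆ ≈ uxx⋆`, which forces `y ≈ ux`; here `u` acts isometrically on `closure (bA)`.

If `a ≾ b`, the elements `yₙ = sqrt b * dₙ` satisfy `yₙ⋆yₙ → a`. Moving each by such an isometry
makes the sequence Cauchy without changing `yₙ⋆yₙ`, and the limit lies in `factorizations a b`
(`factorizations_nonempty`).

If `a ∼ b`, both sets of factorizations are non-empty. In the complete metric space `factorizations
a b`, coming within `1/(n+1)` of `sqrt b` by elements of `xA` is an open condition on `x`, and a
dense one by a back-and-forth argument (`exists_mem_factorizations_norm_sub_lt`). By Baire, some `x`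
has `sqrt b` in `closure (xA)`, and its embedding is onto. -/

/-! ### Polar decomposition and the perturbation estimate -/

section Polar

variable {C : Type*} [CStarAlgebra C]

/-- With `r² = ‖p² - q²‖` one has `p² ≤ q² + r² ≤ (q + r)²`, and operator monotonicity of the square
root gives `p ≤ q + r`; then exchange `p` and `q`. -/
theorem norm_sub_sq_le_norm_sq_sub_sq [PartialOrder C] [StarOrderedRing C] {p q : C}
    (hp : 0 ≤ p) (hq : 0 ≤ q) : ‖p - q‖ ^ 2 ≤ ‖p * p - q * q‖ := by
  have key : ∀ {p q : C}, 0 ≤ p → 0 ≤ q →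
      p - q ≤ algebraMap ℝ C √‖p * p - q * q‖ := by
    intro p q hp hq
    set r : ℝ := √‖p * p - q * q‖ with hr
    have hr0 : 0 ≤ r := Real.sqrt_nonneg _
    have hrr : r * r = ‖p * p - q * q‖ := Real.mul_self_sqrt (norm_nonneg _)
    have hsa : IsSelfAdjoint (p * p - q * q) := by
      have h1 : IsSelfAdjoint p := hp.isSelfAdjoint
      have h2 : IsSelfAdjoint q := hq.isSelfAdjoint
      simp [isSelfAdjoint_iff, h1.star_eq, h2.star_eq]
    have h1 : p * p ≤ q * q + algebraMap ℝ C (r * r) := by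
      rw [hrr]
      exact sub_le_iff_le_add'.1 hsa.le_algebraMap_norm_self
    have hrC : 0 ≤ algebraMap ℝ C r := algebraMap_nonneg C hr0
    have h2 : p * p ≤ (q + algebraMap ℝ C r) * (q + algebraMap ℝ C r) := by
      refine h1.trans ?_
      have h3 : (q + algebraMap ℝ C r) * (q + algebraMap ℝ C r)
          = q * q + algebraMap ℝ C (r * r) + (2 * r) • q := by
        simp only [Algebra.algebraMap_eq_smul_one, add_mul, mul_add, smul_mul_assoc,
          mul_smul_comm, one_mul, mul_one, smul_add, mul_smul, two_smul]
        abel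
      rw [h3]
      exact le_add_of_nonneg_right (smul_nonneg (by positivity) hq)
    have h4 := CFC.sqrt_le_sqrt _ _ h2
    rw [CFC.sqrt_mul_self p hp, CFC.sqrt_mul_self _ (add_nonneg hq hrC)] at h4
    exact sub_le_iff_le_add'.2 h4
  have hsa : IsSelfAdjoint (p - q) := hp.isSelfAdjoint.sub hq.isSelfAdjoint
  have h1 := key hp hq
  have h2 := key hq hp
  rw [norm_sub_rev] at h2
  set r : ℝ := √‖p * p - q * q‖ with hr
  have hr0 : 0 ≤ r := Real.sqrt_nonneg _
  have hrr : r ^ 2 = ‖p * p - q * q‖ := Real.sq_sqrt (norm_nonneg _)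
  rw [← hrr]
  refine pow_le_pow_left₀ (norm_nonneg _) ?_ 2
  rcases subsingleton_or_nontrivial C with hC | hC
  · simpa [Subsingleton.elim (p - q) 0] using hr0
  rcases CStarAlgebra.norm_or_neg_norm_mem_spectrum hsa with h | h
  · exact (le_algebraMap_iff_spectrum_le hsa).1 h1 _ h
  · have := (algebraMap_le_iff_le_spectrum (r := -r) hsa).1
      (by rw [map_neg]; exact neg_le.1 (by rwa [neg_sub])) _ h
    linarith

/-- Polar decomposition `g = u * p` of an invertible element of a closed star subalgebra. -/
theorem exists_isometry_mul_eq (S : StarSubalgebra ℂ C) (hS : IsClosed (S : Set C)) {g : C}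
    (hgS : g ∈ S) (hg : IsUnit g) :
    ∃ u ∈ S, ∃ p : C, star u * u = 1 ∧ g = u * p ∧
      ∀ x : C, ‖p - x * star x‖ ^ 2 ≤ ‖star g * g - x * star x * (x * star x)‖ := by
  let _ := CStarAlgebra.spectralOrder C
  have _ := CStarAlgebra.spectralOrderedRing C
  have hpos : IsStrictlyPositive (star g * g) :=
    IsStrictlyPositive.iff_of_unital.2 ⟨star_mul_self_nonneg g, hg.star.mul hg⟩
  refine ⟨g * (star g * g) ^ (-(1 / 2) : ℝ), ?_, CFC.abs g, ?_, ?_, fun x => ?_⟩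
  · refine mul_mem hgS ?_
    rw [CFC.rpow_eq_cfc_real]
    have : IsClosed (S : Set C) := hS
    exact cfc_mem (𝕜' := ℂ) _ (mul_mem (star_mem hgS) hgS)
  · rw [star_mul, (CFC.rpow_nonneg (a := star g * g)).isSelfAdjoint.star_eq, mul_assoc,
      ← mul_assoc (star g), ← mul_assoc]
    exact CFC.conjugate_rpow_neg_one_half _
  · rw [CFC.abs, CFC.sqrt_eq_rpow, mul_assoc, CFC.rpow_neg_mul_rpow, mul_one]
  · refine (norm_sub_sq_le_norm_sq_sub_sq (CFC.abs_nonneg g) (mul_star_self_nonneg x)).trans ?_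
    rw [CFC.abs_mul_abs]

/-- Two elements with nearby absolute values nearly differ by an isometry of `S`, provided that
`y * star x` is a limit of invertibles of `S`. -/
theorem exists_isometry_norm_sub_le (S : StarSubalgebra ℂ C) (hS : IsClosed (S : Set C))
    {x y : C} {M ε : ℝ} (hx : ‖x‖ ≤ M) (hy : ‖y‖ ≤ M) (hε : 0 < ε)
    (hxy : y * star x ∈ closure {g : C | g ∈ S ∧ IsUnit g}) :
    ∃ u ∈ S, star u * u = 1 ∧ ‖y - u * x‖ ^ 2 ≤ 4 * M * √‖star x * x - star y * y‖ + ε := by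
  have hM : 0 ≤ M := (norm_nonneg x).trans hx
  set η := ‖star x * x - star y * y‖ with hη
  have hη0 : 0 ≤ η := norm_nonneg _
  set z := y * star x with hz
  -- `F g` bounds the error of replacing `yx⋆` by `g` and `|g|` by `xx⋆`. By continuity it is nearly
  -- `F z` for invertible `g` near `z`.
  let F : C → ℝ := fun g => ‖g - z‖ + √‖star g * g - x * star x * (x * star x)‖
  have hF : Continuous F := by fun_prop
  have hFz : F z ≤ M * √η := by
    have h1 : star z * z - x * star x * (x * star x)
        = -(x * (star x * x - star y * y) * star x) := by
      simp only [hz, star_mul, star_star]; noncomm_ring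
    simp only [F, sub_self, norm_zero, zero_add, h1, norm_neg]
    refine Real.sqrt_le_iff.2 ⟨by positivity, ?_⟩
    rw [mul_pow, Real.sq_sqrt hη0]
    calc _ ≤ ‖x‖ * η * ‖star x‖ := (norm_mul_le _ _).trans (by gcongr; exact norm_mul_le _ _)
      _ ≤ M * η * M := by rw [norm_star]; gcongr
      _ = _ := by ring
  obtain ⟨g, hgF, hgS, hgu⟩ := mem_closure_iff.1 hxy (F ⁻¹' Set.Iio (F z + ε / 2))
    (isOpen_Iio.preimage hF) (by simp [hε])
  obtain ⟨u, huS, p, huu, hgp, hp⟩ := exists_isometry_mul_eq S hS hgS hgu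
  refine ⟨u, huS, huu, ?_⟩
  have hu1 : ‖u‖ ≤ 1 := by
    have h1 := CStarRing.norm_star_mul_self (x := u)
    rw [huu] at h1
    rcases subsingleton_or_nontrivial C with h | h
    · simp [Subsingleton.elim u 0]
    · rw [norm_one] at h1
      nlinarith [norm_nonneg u]
  have hgF' : F g < F z + ε / 2 := hgF
  set h := y - u * x with hh
  have hα : ‖h * star x‖ ≤ F g := by
    have h1 : h * star x = (z - g) + u * (p - x * star x) := by
      rw [hgp, hh, hz]; noncomm_ring
    rw [h1]
    refine (norm_add_le _ _).trans ?_
    simp only [F]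
    rw [norm_sub_rev z g]
    gcongr
    refine (norm_mul_le _ _).trans ?_
    refine (mul_le_of_le_one_left (norm_nonneg _) hu1).trans (Real.le_sqrt_of_sq_le (hp x))
  set α := ‖h * star x‖ with hαdef
  have hα0 : 0 ≤ α := norm_nonneg _
  have hhM : ‖h‖ ≤ 2 * M := by
    refine (norm_sub_le _ _).trans ?_
    have := (norm_mul_le u x).trans (mul_le_of_le_one_left (norm_nonneg _) hu1)
    linarith
  -- Smallness passes from `hx⋆` to `hy⋆` because `x⋆x ≈ y⋆y`; then `hh⋆ = hy⋆ - hx⋆u⋆` is small as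
  -- well.
  have hy2 : ‖h * star y‖ ≤ α + √η * ‖h‖ := by
    refine abs_le_of_sq_le_sq' ?_ (by positivity) |>.2
    have e1 : h * star y * star (h * star y)
        = h * star x * star (h * star x) - h * (star x * x - star y * y) * star h := by
      simp only [star_mul, star_star]; noncomm_ring
    have e2 : ‖h * star y‖ ^ 2 ≤ α ^ 2 + η * ‖h‖ ^ 2 := by
      rw [sq, ← CStarRing.norm_self_mul_star, e1]
      refine (norm_sub_le _ _).trans ?_
      rw [CStarRing.norm_self_mul_star, ← sq]
      gcongr
      calc _ ≤ ‖h‖ * η * ‖star h‖ := (norm_mul_le _ _).trans (by gcongr; exact norm_mul_le _ _)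
        _ = _ := by rw [norm_star]; ring
    have e3 : √η ^ 2 = η := Real.sq_sqrt hη0
    have e4 : 0 ≤ α * (√η * ‖h‖) := by positivity
    nlinarith
  have hfin : ‖h‖ ^ 2 ≤ ‖h * star y‖ + α := by
    rw [sq, ← CStarRing.norm_self_mul_star]
    have e1 : h * star h = h * star y - h * star x * star u := by
      conv_lhs => rw [hh]
      simp only [star_sub, star_mul]
      rw [← hh]; noncomm_ring
    rw [e1]
    refine (norm_sub_le _ _).trans ?_
    gcongr
    refine (norm_mul_le _ _).trans (mul_le_of_le_one_right (norm_nonneg _) ?_)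
    rwa [norm_star]
  have : √η * ‖h‖ ≤ √η * (2 * M) := by gcongr
  linarith

end Polar

/-! ### Closed right ideals and hereditary subalgebras -/

section HereditarySubalgebra

variable {A : Type*} [NonUnitalCStarAlgebra A]

theorem mul_mem_closedRightIdeal_self (a c : A) : a * c ∈ closedRightIdeal a := by
  rw [← SetLike.mem_coe, coe_closedRightIdeal]
  exact subset_closure ⟨c, rfl⟩

theorem isClosed_closedRightIdeal (a : A) : IsClosed (closedRightIdeal a : Set A) :=
  Submodule.isClosed_topologicalClosure _

theorem exists_norm_sub_mul_lt {a x : A} (hx : x ∈ closedRightIdeal a) {ε : ℝ} (hε : 0 < ε) :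
    ∃ c, ‖x - a * c‖ < ε := by
  rw [← SetLike.mem_coe, coe_closedRightIdeal] at hx
  obtain ⟨_, ⟨c, rfl⟩, hc⟩ := Metric.mem_closure_iff.1 hx ε hε
  exact ⟨c, by rwa [← dist_eq_norm]⟩

theorem mem_closedRightIdeal_of_forall_exists {a x : A}
    (h : ∀ ε > 0, ∃ y ∈ closedRightIdeal a, ‖x - y‖ < ε) : x ∈ closedRightIdeal a := by
  rw [← SetLike.mem_coe, ← (isClosed_closedRightIdeal a).closure_eq]
  refine Metric.mem_closure_iff.2 fun ε hε => ?_
  obtain ⟨y, hy, hxy⟩ := h ε hε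
  exact ⟨y, hy, by rwa [dist_eq_norm]⟩

theorem closedRightIdeal_le {a b : A} (h : a ∈ closedRightIdeal b) :
    closedRightIdeal a ≤ closedRightIdeal b := by
  refine Submodule.topologicalClosure_minimal _ ?_ (isClosed_closedRightIdeal b)
  rintro _ ⟨c, rfl⟩
  exact mul_mem_closedRightIdeal b h c

/-- The hereditary subalgebra `closure (bA) ∩ closure (Ab)` generated by `b`. -/
def hereditarySubalgebra (b : A) : NonUnitalStarSubalgebra ℂ A where
  carrier := {z | z ∈ closedRightIdeal b ∧ star z ∈ closedRightIdeal b}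
  add_mem' := fun {x y} hx hy =>
    ⟨add_mem hx.1 hy.1, by rw [star_add]; exact add_mem hx.2 hy.2⟩
  zero_mem' := ⟨zero_mem _, by rw [star_zero]; exact zero_mem _⟩
  mul_mem' := fun hx hy => ⟨mul_mem_closedRightIdeal b hx.1 _, by
    rw [star_mul]; exact mul_mem_closedRightIdeal b hy.2 _⟩
  smul_mem' := fun c x hx => ⟨Submodule.smul_mem _ c hx.1, by
    rw [star_smul]; exact Submodule.smul_mem _ _ hx.2⟩
  star_mem' := fun hx => ⟨hx.2, by rw [star_star]; exact hx.1⟩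

variable [PartialOrder A] [StarOrderedRing A]

theorem exists_contraction_norm_sub_mul_le {b : A} (hb : 0 ≤ b) {δ : ℝ} (hδ : 0 < δ) :
    ∃ k : A, star (b * k) = b * k ∧ ‖b * k‖ ≤ 1 ∧ ‖b - b * k * b‖ ≤ δ := by
  have hbs : IsSelfAdjoint b := hb.isSelfAdjoint
  have hd : ∀ t : ℝ, t ^ 2 + δ ^ 2 ≠ 0 := fun t => by
    have := pow_pos hδ 2
    positivity
  -- `t f(t) = t²/(t² + δ²)` lies in `[0, 1]` and leaves the remainder `δ²t/(t² + δ²)`, of modulus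
  -- at most `δ`.
  let f : ℝ → ℝ := fun t => t / (t ^ 2 + δ ^ 2)
  have hf : Continuous f := by fun_prop (disch := exact hd _)
  have hf0 : f 0 = 0 := by simp [f]
  have e1 : b * cfcₙ f b = cfcₙ (fun t => t * f t) b := by
    rw [cfcₙ_mul (fun t => t) f b (by fun_prop) rfl (by fun_prop) hf0, cfcₙ_id' ℝ b]
  have e2 : b - b * cfcₙ f b * b = cfcₙ (fun t => t - t * f t * t) b := by
    rw [cfcₙ_sub (fun t => t) (fun t => t * f t * t) b (by fun_prop) rfl (by fun_prop) (by simp),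
      cfcₙ_mul (fun t => t * f t) (fun t => t) b (by fun_prop) (by simp) (by fun_prop) rfl,
      cfcₙ_id' ℝ b, e1]
  refine ⟨cfcₙ f b, ?_, ?_, ?_⟩
  · rw [e1]
    exact (cfcₙ_predicate (fun t => t * f t) b : IsSelfAdjoint _).star_eq
  · rw [e1]
    refine norm_cfcₙ_le fun t _ => ?_
    rw [Real.norm_eq_abs, abs_le, ← mul_div_assoc]
    constructor
    · have : 0 ≤ t * t / (t ^ 2 + δ ^ 2) :=
        div_nonneg (mul_self_nonneg t) (by positivity)
      linarith
    · rw [div_le_one (by positivity)]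
      nlinarith
  · rw [e2]
    refine norm_cfcₙ_le fun t _ => ?_
    have e3 : t - t * f t * t = δ * (δ * t / (t ^ 2 + δ ^ 2)) := by
      simp only [f]; field_simp [hd t]; ring
    rw [e3, norm_mul, Real.norm_of_nonneg hδ.le]
    refine mul_le_of_le_one_right hδ.le ?_
    rw [Real.norm_eq_abs, abs_le, le_div_iff₀ (by positivity), div_le_one (by positivity)]
    constructor <;> nlinarith [sq_nonneg (t - δ), sq_nonneg (t + δ)]

/-- Elements `b * k` of `b A` act as approximate left units on `closure (bA)`. -/
theorem exists_contraction_norm_sub_mul_lt {b : A} (hb : 0 ≤ b) {y : A}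
    (hy : y ∈ closedRightIdeal b) {ε : ℝ} (hε : 0 < ε) :
    ∃ k : A, star (b * k) = b * k ∧ ‖b * k‖ ≤ 1 ∧ ‖y - b * k * y‖ < ε := by
  obtain ⟨c, hc⟩ := exists_norm_sub_mul_lt hy (ε := ε / 3) (by positivity)
  obtain ⟨k, hk, hk1, hkb⟩ :=
    exists_contraction_norm_sub_mul_le hb (δ := ε / 3 / (‖c‖ + 1)) (by positivity)
  refine ⟨k, hk, hk1, ?_⟩
  have e : y - b * k * y = (y - b * c) + (b - b * k * b) * c - b * k * (y - b * c) := by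
    noncomm_ring
  have h1 : ‖(b - b * k * b) * c‖ ≤ ε / 3 := by
    refine (norm_mul_le _ _).trans ?_
    calc _ ≤ ε / 3 / (‖c‖ + 1) * (‖c‖ + 1) := by gcongr; linarith
      _ = ε / 3 := by field_simp
  have h2 : ‖b * k * (y - b * c)‖ ≤ ‖y - b * c‖ :=
    (norm_mul_le _ _).trans (mul_le_of_le_one_left (norm_nonneg _) hk1)
  rw [e]
  have := norm_sub_le (y - b * c + (b - b * k * b) * c) (b * k * (y - b * c))
  have := norm_add_le (y - b * c) ((b - b * k * b) * c)
  linarith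

/-- For an approximate left unit `e` of `y`, `‖(1 - e) sqrt x‖² = ‖(1 - e)x(1 - e)‖ ≤ ‖(1 - e)y(1 -
e)‖`, which is small; so `sqrt x` is a limit of elements `e * sqrt x`. -/
theorem sqrt_mem_closedRightIdeal_of_le {b x y : A} (hb : 0 ≤ b) (hx : 0 ≤ x) (hxy : x ≤ y)
    (hy : y ∈ closedRightIdeal b) : CFC.sqrt x ∈ closedRightIdeal b := by
  refine mem_closedRightIdeal_of_forall_exists fun ε hε => ?_
  obtain ⟨k, hk, hk1, hky⟩ :=
    exists_contraction_norm_sub_mul_lt hb hy (ε := ε ^ 2 / 2) (by positivity)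
  set e := b * k with he
  set s := CFC.sqrt x with hs
  have hss : star s = s := (CFC.sqrt_nonneg x).isSelfAdjoint.star_eq
  have hs2 : s * s = x := CFC.sqrt_mul_sqrt_self x hx
  refine ⟨e * s, he ▸ mul_mem_closedRightIdeal b (mul_mem_closedRightIdeal_self b k) s, ?_⟩
  have compress : ∀ t : A, (t - e * t) * star (t - e * t)
      = t * star t - e * (t * star t) - (t * star t - e * (t * star t)) * e := by
    intro t
    rw [star_sub, star_mul, hk]; noncomm_ring
  have h1 : (s - e * s) * star (s - e * s) ≤ y - e * y - (y - e * y) * e := by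
    -- Compressing `y - x = rr⋆` by `1 - e` gives a positive element; writing it through `r - er`
    -- avoids adjoining a unit.
    set r := CFC.sqrt (y - x) with hr
    have hrs : star r = r := (CFC.sqrt_nonneg (y - x)).isSelfAdjoint.star_eq
    have hr2 : r * r = y - x := CFC.sqrt_mul_sqrt_self _ (sub_nonneg.2 hxy)
    have h2 := mul_star_self_nonneg (r - e * r)
    rw [compress, hrs, hr2] at h2
    rw [compress, hss, hs2, ← sub_nonneg]
    convert h2 using 1
    noncomm_ring
  have h3 := CStarAlgebra.norm_le_norm_of_nonneg_of_le (mul_star_self_nonneg _) h1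
  rw [CStarRing.norm_self_mul_star] at h3
  have h4 : ‖y - e * y - (y - e * y) * e‖ ≤ ‖y - e * y‖ + ‖y - e * y‖ :=
    (norm_sub_le _ _).trans (by
      gcongr; exact (norm_mul_le _ _).trans (mul_le_of_le_one_right (norm_nonneg _) hk1))
  refine lt_of_pow_lt_pow_left₀ 2 hε.le ?_
  nlinarith

theorem mem_closedRightIdeal_of_le {b x y : A} (hb : 0 ≤ b) (hx : 0 ≤ x) (hxy : x ≤ y)
    (hy : y ∈ closedRightIdeal b) : x ∈ closedRightIdeal b := by
  rw [← CFC.sqrt_mul_sqrt_self x hx]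
  exact mul_mem_closedRightIdeal b (sqrt_mem_closedRightIdeal_of_le hb hx hxy hy) _

theorem sqrt_mem_closedRightIdeal {b : A} (hb : 0 ≤ b) : CFC.sqrt b ∈ closedRightIdeal b := by
  refine sqrt_mem_closedRightIdeal_of_le hb hb le_rfl ?_
  refine mem_closedRightIdeal_of_forall_exists fun ε hε => ?_
  obtain ⟨k, -, -, h⟩ := exists_contraction_norm_sub_mul_le hb (half_pos hε)
  exact ⟨b * k * b, mul_mem_closedRightIdeal b (mul_mem_closedRightIdeal_self b k) b,
    h.trans_lt (half_lt_self hε)⟩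

theorem closedRightIdeal_sqrt {b : A} (hb : 0 ≤ b) :
    closedRightIdeal (CFC.sqrt b) = closedRightIdeal b := by
  refine le_antisymm (closedRightIdeal_le (sqrt_mem_closedRightIdeal hb)) (closedRightIdeal_le ?_)
  simpa only [CFC.sqrt_mul_sqrt_self b hb] using
    mul_mem_closedRightIdeal_self (CFC.sqrt b) (CFC.sqrt b)

theorem isClosedHereditary_hereditarySubalgebra {b : A} (hb : 0 ≤ b) :
    IsClosedHereditary (hereditarySubalgebra b) where
  isClosed := (isClosed_closedRightIdeal b).inter
    ((isClosed_closedRightIdeal b).preimage continuous_star)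
  hereditary x y hx hxy hy := by
    have h := mem_closedRightIdeal_of_le hb hx hxy hy.1
    exact ⟨h, by rwa [hx.isSelfAdjoint.star_eq]⟩

end HereditarySubalgebra

/-! ### Isometries of `closure (bA)` from the unitization -/

section Transport

variable {A : Type*} [NonUnitalCStarAlgebra A]

theorem mem_map_inrHom_iff {R : Submodule ℂ A} {x : A} :
    (x : Unitization ℂ A) ∈ R.map (Unitization.inrHom ℂ ℂ A) ↔ x ∈ R :=
  ⟨fun ⟨_, hy, h⟩ => Unitization.inr_injective h ▸ hy, fun hx => ⟨x, hx, rfl⟩⟩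

theorem isClosed_map_inrHom {R : Submodule ℂ A} (hR : IsClosed (R : Set A)) :
    IsClosed (R.map (Unitization.inrHom ℂ ℂ A) : Set (Unitization ℂ A)) := by
  rw [Submodule.map_coe]
  exact (Unitization.isometry_inr (𝕜 := ℂ) (A := A)).isClosedEmbedding.isClosedMap _ hR

/-- The elements `w` of the unitization such that left multiplication by `w` and `star w` maps
`R` to itself. -/
def stabilizerSubalgebra (R : Submodule ℂ A) : StarSubalgebra ℂ (Unitization ℂ A) where
  carrier := {w | ∀ x ∈ R.map (Unitization.inrHom ℂ ℂ A),
    w * x ∈ R.map (Unitization.inrHom ℂ ℂ A) ∧ star w * x ∈ R.map (Unitization.inrHom ℂ ℂ A)}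
  add_mem' := fun {v w} hv hw x hx => by
    rw [star_add, add_mul, add_mul]
    exact ⟨add_mem (hv x hx).1 (hw x hx).1, add_mem (hv x hx).2 (hw x hx).2⟩
  mul_mem' := fun {v w} hv hw x hx => by
    rw [star_mul, mul_assoc, mul_assoc]
    exact ⟨(hv _ (hw x hx).1).1, (hw _ (hv x hx).2).2⟩
  algebraMap_mem' := fun c x hx => by
    rw [← algebraMap_star_comm, ← Algebra.smul_def, ← Algebra.smul_def]
    exact ⟨Submodule.smul_mem _ _ hx, Submodule.smul_mem _ _ hx⟩
  star_mem' := fun {w} hw x hx => by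
    rw [star_star]
    exact (hw x hx).symm

/-- Closedness keeps the continuous functional calculus inside, so the isometric factor of an
invertible of this subalgebra also stabilizes `R`. -/
theorem isClosed_stabilizerSubalgebra {R : Submodule ℂ A} (hR : IsClosed (R : Set A)) :
    IsClosed (stabilizerSubalgebra R : Set (Unitization ℂ A)) := by
  have h := isClosed_map_inrHom hR
  have : (stabilizerSubalgebra R : Set (Unitization ℂ A))
      = ⋂ x ∈ R.map (Unitization.inrHom ℂ ℂ A),
        {w | w * x ∈ R.map (Unitization.inrHom ℂ ℂ A)} ∩
        {w | star w * x ∈ R.map (Unitization.inrHom ℂ ℂ A)} := by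
    ext w
    simp only [Set.mem_iInter]
    rfl
  rw [this]
  refine isClosed_biInter fun x _ => IsClosed.inter ?_ ?_
  · exact h.preimage (continuous_mul_const x)
  · exact h.preimage ((continuous_mul_const x).comp continuous_star)

theorem inr_mem_stabilizerSubalgebra {b v : A} (hv : v ∈ hereditarySubalgebra b) :
    (v : Unitization ℂ A) ∈ stabilizerSubalgebra (closedRightIdeal b) := by
  rintro _ ⟨x, -, rfl⟩
  refine ⟨?_, ?_⟩
  · rw [Unitization.inrHom_apply, ← Unitization.inr_mul, mem_map_inrHom_iff]
    exact mul_mem_closedRightIdeal b hv.1 x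
  · rw [Unitization.inrHom_apply, ← Unitization.inr_star, ← Unitization.inr_mul, mem_map_inrHom_iff]
    exact mul_mem_closedRightIdeal b hv.2 x

theorem continuous_starMap_subtype (B : NonUnitalStarSubalgebra ℂ A) :
    Continuous (Unitization.starMap (NonUnitalStarSubalgebraClass.subtype B)) := by
  have h : ∀ u : Unitization ℂ B, Unitization.starMap (NonUnitalStarSubalgebraClass.subtype B) u
      = algebraMap ℂ (Unitization ℂ A) u.fst + ((u.snd : A) : Unitization ℂ A) := by
    intro u
    induction u using Unitization.ind with
    | inl_add_inr r a => simp
  simp_rw [funext h]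
  have h1 : Continuous fun u : Unitization ℂ B => u.fst := Unitization.continuous_fst
  have h2 : Continuous fun u : Unitization ℂ B => u.snd := Unitization.continuous_snd
  exact ((algebraMapCLM ℂ (Unitization ℂ A)).continuous.comp h1).add
    ((Unitization.isometry_inr (𝕜 := ℂ) (A := A)).continuous.comp (continuous_subtype_val.comp h2))

theorem starMap_subtype_mem_stabilizerSubalgebra {b : A}
    (u : Unitization ℂ (hereditarySubalgebra b)) :
    Unitization.starMap (NonUnitalStarSubalgebraClass.subtype (hereditarySubalgebra b)) u ∈
      stabilizerSubalgebra (closedRightIdeal b) := by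
  induction u using Unitization.ind with
  | inl_add_inr r a =>
    rw [map_add, Unitization.starMap_inl, Unitization.starMap_inr]
    exact add_mem (algebraMap_mem _ r) (inr_mem_stabilizerSubalgebra a.2)

variable [PartialOrder A]

theorem inr_mem_closure_isUnit [StarOrderedRing A] (hA : AlmostStableRankOne A) {b z : A}
    (hb : 0 ≤ b) (hz : z ∈ hereditarySubalgebra b) :
    (z : Unitization ℂ A) ∈
      closure {g | g ∈ stabilizerSubalgebra (closedRightIdeal b) ∧ IsUnit g} := by
  have h := hA _ (isClosedHereditary_hereditarySubalgebra hb) ⟨z, hz⟩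
  have := map_mem_closure (continuous_starMap_subtype (hereditarySubalgebra b)) h
    (t := {g | g ∈ stabilizerSubalgebra (closedRightIdeal b) ∧ IsUnit g})
    fun u hu => ⟨starMap_subtype_mem_stabilizerSubalgebra u, hu.map _⟩
  simpa using this

/-- Elements of `closure (bA)` with nearby absolute values are nearly in the same orbit under the
isometric endomorphisms of `closure (bA)`. -/
theorem exists_isometric_map_norm_sub_sq_le [StarOrderedRing A] (hA : AlmostStableRankOne A) {b : A}
    (hb : 0 ≤ b) {x y : A} (hxb : x ∈ closedRightIdeal b) (hyb : y ∈ closedRightIdeal b)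
    {M ε : ℝ} (hx : ‖x‖ ≤ M) (hy : ‖y‖ ≤ M) (hε : 0 < ε) :
    ∃ W : A → A, (∀ z ∈ closedRightIdeal b, W z ∈ closedRightIdeal b) ∧
      (∀ z, star (W z) * W z = star z * z) ∧ (∀ z c, W (z * c) = W z * c) ∧
      ‖y - W x‖ ^ 2 ≤ 4 * M * √‖star x * x - star y * y‖ + ε := by
  have hz : y * star x ∈ hereditarySubalgebra b :=
    ⟨mul_mem_closedRightIdeal b hyb _, by
      rw [star_mul, star_star]; exact mul_mem_closedRightIdeal b hxb _⟩
  obtain ⟨u, huS, huu, hu⟩ := exists_isometry_norm_sub_le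
    (stabilizerSubalgebra (closedRightIdeal b))
    (isClosed_stabilizerSubalgebra (isClosed_closedRightIdeal b))
    (x := (x : Unitization ℂ A)) (y := (y : Unitization ℂ A)) (M := M) (ε := ε)
    (by rwa [Unitization.norm_inr]) (by rwa [Unitization.norm_inr]) hε
    (by
      rw [← Unitization.inr_star, ← Unitization.inr_mul]
      exact inr_mem_closure_isUnit hA hb hz)
  -- `A` is an ideal of its unitization, so left multiplication by `u` restricts to `A`.
  have hW : ∀ z : A, ∃ w : A, (w : Unitization ℂ A) = u * z := fun z =>
    ⟨(u * (z : Unitization ℂ A)).snd, by ext <;> simp⟩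
  choose W hW using hW
  have hWW : ∀ z, star (W z) * W z = star z * z := fun z => by
    refine Unitization.inr_injective (R := ℂ) ?_
    rw [Unitization.inr_mul, Unitization.inr_star, hW, star_mul, mul_assoc, ← mul_assoc (star u),
      huu, one_mul, Unitization.inr_mul, Unitization.inr_star]
  refine ⟨W, fun z hz => ?_, hWW, fun z c => ?_, ?_⟩
  · rw [← mem_map_inrHom_iff, hW]
    exact (huS _ (mem_map_inrHom_iff.2 hz)).1
  · refine Unitization.inr_injective (R := ℂ) ?_
    rw [hW, Unitization.inr_mul, Unitization.inr_mul, hW, mul_assoc]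
  · rw [← Unitization.norm_inr (𝕜 := ℂ) (y - W x), ← Unitization.norm_inr (𝕜 := ℂ) (star x * x - _)]
    simpa only [Unitization.inr_sub, Unitization.inr_mul, Unitization.inr_star, hW] using hu

end Transport

/-! ### Factorizations `x⋆x = a` with `x` in `closure (bA)` -/

section Factorization

variable {A : Type*} [NonUnitalCStarAlgebra A]

theorem norm_eq_of_star_mul_self_eq {x y : A} (h : star x * x = star y * y) : ‖x‖ = ‖y‖ := by
  rw [← sq_eq_sq₀ (norm_nonneg _) (norm_nonneg _), sq, sq, ← CStarRing.norm_star_mul_self, h,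
    CStarRing.norm_star_mul_self]

/-- `(x - xc)⋆(x - xc)` depends only on `x⋆x` and `c`. This transfers estimates at `sqrt a` to any
`x` with `x⋆x = a`. -/
theorem norm_sub_mul_eq_of_star_mul_self_eq {x y : A} (h : star x * x = star y * y) (c : A) :
    ‖x - x * c‖ = ‖y - y * c‖ := by
  refine norm_eq_of_star_mul_self_eq ?_
  have e : ∀ z : A, star (z - z * c) * (z - z * c)
      = star z * z - star z * z * c - (star c * (star z * z) - star c * (star z * z) * c) := by
    intro z
    rw [star_sub, star_mul]; noncomm_ring
  rw [e, e, h]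

variable (a b : A) in
/-- The elements `x` of `closure (bA)` with `star x * x = a`; they parametrize the embeddings of
`closure (aA)` in `closure (bA)`. -/
def factorizations : Set A := {x | x ∈ closedRightIdeal b ∧ star x * x = a}

theorem isClosed_factorizations (a b : A) : IsClosed (factorizations a b) :=
  (isClosed_closedRightIdeal b).inter (isClosed_eq (by fun_prop) continuous_const)

variable [PartialOrder A] [StarOrderedRing A]

theorem cuntzBelow_of_mem_factorizations {a b x : A} (hb : 0 ≤ b) (hx : x ∈ factorizations a b) :
    CuntzBelow a b := by
  have h : x ∈ closure {y | ∃ c, y = CFC.sqrt b * c} := by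
    rw [← coe_closedRightIdeal, closedRightIdeal_sqrt hb]
    exact hx.1
  obtain ⟨u, hu, hux⟩ := mem_closure_iff_seq_limit.1 h
  choose d hd using hu
  refine ⟨d, ?_⟩
  have h2 : Filter.Tendsto (fun n => star (u n) * u n) Filter.atTop (nhds (star x * x)) :=
    hux.star.mul hux
  rw [hx.2] at h2
  refine h2.congr fun n => ?_
  rw [hd, star_mul, (CFC.sqrt_nonneg b).isSelfAdjoint.star_eq, mul_assoc,
    ← mul_assoc (CFC.sqrt b), CFC.sqrt_mul_sqrt_self b hb, mul_assoc]

/-- Elements `x` and `y` of `closure (bA)` with both `star x * x` and `star y * y` close to `a` are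
matched, up to a small error, by an isometric endomorphism of `closure (bA)`. -/
theorem exists_pos_forall_exists_norm_sub_lt (hA : AlmostStableRankOne A) {b : A} (hb : 0 ≤ b)
    (a : A) {ε : ℝ} (hε : 0 < ε) : ∃ δ > 0, ∀ x ∈ closedRightIdeal b, ∀ y ∈ closedRightIdeal b,
      ‖star x * x - a‖ < δ → ‖star y * y - a‖ < δ →
      ∃ W : A → A, (∀ z ∈ closedRightIdeal b, W z ∈ closedRightIdeal b) ∧
      (∀ z, star (W z) * W z = star z * z) ∧ (∀ z c, W (z * c) = W z * c) ∧
      ‖y - W x‖ < ε := by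
  set M : ℝ := ‖a‖ + 1 with hM
  have hM1 : 1 ≤ M := by linarith [norm_nonneg a]
  obtain ⟨δ, hδ, hδ1, hδε⟩ : ∃ δ > 0, δ ≤ 1 ∧ 4 * M * √(2 * δ) + ε ^ 2 / 2 < ε ^ 2 := by
    have h : Filter.Tendsto (fun δ : ℝ => 4 * M * √(2 * δ) + ε ^ 2 / 2) (nhdsWithin 0 (Set.Ioi 0))
        (nhds (ε ^ 2 / 2)) := by
      refine Filter.Tendsto.mono_left ?_ nhdsWithin_le_nhds
      have : Continuous fun δ : ℝ => 4 * M * √(2 * δ) + ε ^ 2 / 2 := by fun_prop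
      simpa using this.tendsto 0
    have h1 := h.eventually_lt_const (u := ε ^ 2) (by have := pow_pos hε 2; linarith)
    obtain ⟨δ, h1, h2⟩ := (h1.and (Ioc_mem_nhdsGT one_pos)).exists
    exact ⟨δ, h2.1, h2.2, h1⟩
  refine ⟨δ, hδ, fun x hx y hy hxa hya => ?_⟩
  have hnorm : ∀ z : A, ‖star z * z - a‖ < δ → ‖z‖ ≤ M := by
    intro z hz
    have h1 : ‖z‖ * ‖z‖ ≤ M := by
      rw [← CStarRing.norm_star_mul_self]
      have := norm_add_le (star z * z - a) a
      rw [sub_add_cancel] at this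
      linarith
    nlinarith [norm_nonneg z]
  obtain ⟨W, h1, h2, h3, h5⟩ := exists_isometric_map_norm_sub_sq_le hA hb hx hy (hnorm x hxa)
    (hnorm y hya) (ε := ε ^ 2 / 2) (by positivity)
  refine ⟨W, h1, h2, h3, lt_of_pow_lt_pow_left₀ 2 hε.le (lt_of_le_of_lt ?_ hδε)⟩
  refine h5.trans ?_
  gcongr
  have := norm_sub_le (star x * x - a) (star y * y - a)
  rw [sub_sub_sub_cancel_right] at this
  linarith

theorem factorizations_nonempty (hA : AlmostStableRankOne A) {a b : A} (hb : 0 ≤ b)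
    (hab : CuntzBelow a b) : (factorizations a b).Nonempty := by
  obtain ⟨d, hd⟩ := hab
  have hy : ∀ n, CFC.sqrt b * d n ∈ closedRightIdeal b := fun n =>
    mul_mem_closedRightIdeal b (sqrt_mem_closedRightIdeal hb) _
  have hya : Filter.Tendsto (fun n => star (CFC.sqrt b * d n) * (CFC.sqrt b * d n))
      Filter.atTop (nhds a) := by
    refine hd.congr fun n => ?_
    rw [star_mul, (CFC.sqrt_nonneg b).isSelfAdjoint.star_eq, mul_assoc _ (CFC.sqrt b),
      ← mul_assoc (CFC.sqrt b), CFC.sqrt_mul_sqrt_self b hb, mul_assoc]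
  choose δ hδ hstep using fun n : ℕ => exists_pos_forall_exists_norm_sub_lt hA hb a
    (ε := 1 / 2 * (1 / 2) ^ n) (by positivity)
  -- The `n`-th term takes part in steps `n - 1` and `n`, hence the minimum; at `n = 0` truncated
  -- subtraction gives `δ 0` twice.
  obtain ⟨φ, hmono, hφ⟩ := Filter.extraction_forall_of_eventually' (P := fun n k =>
      ‖star (CFC.sqrt b * d k) * (CFC.sqrt b * d k) - a‖ < min (δ n) (δ (n - 1))) fun n => by
    have := (tendsto_iff_norm_sub_tendsto_zero.1 hya).eventually_lt_const
      (lt_min (hδ n) (hδ (n - 1)))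
    exact Filter.eventually_atTop.1 this
  set y : ℕ → A := fun n => CFC.sqrt b * d (φ n) with hydef
  have hnext : ∀ n (x : factorizations (star (y n) * y n) b),
      ∃ x' : factorizations (star (y (n + 1)) * y (n + 1)) b,
        dist (x : A) x' ≤ 1 / 2 * (1 / 2) ^ n := by
    rintro n ⟨x, hxb, hx⟩
    -- The next term is moved close to the already corrected `x`; the geometric bounds then make the
    -- corrected terms Cauchy.
    obtain ⟨W, h1, h2, -, h5⟩ := hstep n (y (n + 1)) (hy _) x hxb
      ((hφ (n + 1)).trans_le (min_le_right _ _))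
      (by rw [hx]; exact (hφ n).trans_le (min_le_left _ _))
    exact ⟨⟨W (y (n + 1)), h1 _ (hy _), h2 _⟩, by rw [dist_eq_norm]; exact h5.le⟩
  choose next hnext using hnext
  let X : ∀ n, factorizations (star (y n) * y n) b :=
    fun n => Nat.rec ⟨y 0, hy _, rfl⟩ (fun n x => next n x) n
  have hX : ∀ n, dist (X n).1 (X (n + 1)).1 ≤ 1 / 2 * (1 / 2) ^ n := fun n => hnext n (X n)
  obtain ⟨x, hx⟩ := cauchySeq_tendsto_of_complete
    (cauchySeq_of_le_geometric (1 / 2) (1 / 2) (by norm_num) hX)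
  refine ⟨x, (isClosed_closedRightIdeal b).mem_of_tendsto hx
    (Filter.Eventually.of_forall fun n => (X n).2.1), ?_⟩
  have h2 : Filter.Tendsto (fun n => star (X n).1 * (X n).1) Filter.atTop (nhds a) := by
    simp only [fun n => (X n).2.2]
    exact hya.comp hmono.tendsto_atTop
  exact tendsto_nhds_unique (hx.star.mul hx) h2

/-- Given `x` with `star x * x = a` and some `y` with `star y * y = b`, the element `y` can be
chosen such that the embedding it defines approximately inverts the one defined by `x` at
`sqrt a`. -/
theorem exists_mem_factorizations_norm_lt (hA : AlmostStableRankOne A) {a b x : A} (ha : 0 ≤ a)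
    (hb : 0 ≤ b) (hx : x ∈ factorizations a b) (hne : (factorizations b a).Nonempty) {ε : ℝ}
    (hε : 0 < ε) :
    ∃ y ∈ factorizations b a, ∃ d, ‖x - CFC.sqrt b * d‖ < ε ∧ ‖CFC.sqrt a - y * d‖ < ε := by
  obtain ⟨y₀, hy₀⟩ := hne
  obtain ⟨δ, hδ, hstep⟩ := exists_pos_forall_exists_norm_sub_lt hA ha a hε
  have hsa : star (CFC.sqrt a) * CFC.sqrt a = a := by
    rw [(CFC.sqrt_nonneg a).isSelfAdjoint.star_eq, CFC.sqrt_mul_sqrt_self a ha]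
  have hsb : star (CFC.sqrt b) * CFC.sqrt b = b := by
    rw [(CFC.sqrt_nonneg b).isSelfAdjoint.star_eq, CFC.sqrt_mul_sqrt_self b hb]
  obtain ⟨d, hdδ, hdε⟩ : ∃ d, ‖star (CFC.sqrt b * d) * (CFC.sqrt b * d) - a‖ < δ ∧
      ‖x - CFC.sqrt b * d‖ < ε := by
    have h1 : x ∈ closure {z | ∃ c, z = CFC.sqrt b * c} := by
      rw [← coe_closedRightIdeal, closedRightIdeal_sqrt hb]
      exact hx.1
    have h2 : Continuous fun z : A => ‖star z * z - a‖ := by fun_prop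
    have h3 : Continuous fun z : A => ‖x - z‖ := by fun_prop
    obtain ⟨_, ⟨h4, h5⟩, d, rfl⟩ := mem_closure_iff.1 h1 _
      ((isOpen_Iio (a := δ)).preimage h2 |>.inter ((isOpen_Iio (a := ε)).preimage h3))
      ⟨by simpa [hx.2] using hδ, by simpa using hε⟩
    exact ⟨d, h4, h5⟩
  -- As `y₀⋆y₀ = b`, the element `y₀d` has nearly the absolute value of `sqrt a`. The isometry `W`
  -- taking `y₀d` near `sqrt a` turns `y₀` into the required factorization `W y₀`.
  have hdd : star (y₀ * d) * (y₀ * d) = star (CFC.sqrt b * d) * (CFC.sqrt b * d) := by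
    rw [star_mul, star_mul, mul_assoc, mul_assoc, ← mul_assoc (star y₀), hy₀.2,
      ← mul_assoc (star (CFC.sqrt b)), hsb]
  obtain ⟨W, h1, h2, h3, h5⟩ := hstep (y₀ * d) (mul_mem_closedRightIdeal a hy₀.1 d)
    (CFC.sqrt a) (sqrt_mem_closedRightIdeal ha) (by rwa [hdd]) (by rwa [hsa, sub_self, norm_zero])
  exact ⟨W y₀, ⟨h1 _ hy₀.1, (h2 y₀).trans hy₀.2⟩, d, hdε, by rwa [← h3]⟩

/-- Back and forth: `x` yields `y` and `d` with `x ≈ sqrt b * d` and `sqrt a ≈ yd`; then `y` yields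
`x'` and `e` with `y ≈ sqrt a * e` and `sqrt b ≈ x'e`. From `sqrt a ≈ sqrt a * ed` follows `x' ≈
x'ed ≈ sqrt b * d ≈ x`. -/
theorem exists_mem_factorizations_norm_sub_lt (hA : AlmostStableRankOne A) {a b x : A} (ha : 0 ≤ a)
    (hb : 0 ≤ b) (hx : x ∈ factorizations a b) (hne : (factorizations b a).Nonempty) {ε : ℝ}
    (hε : 0 < ε) :
    ∃ x' ∈ factorizations a b, ‖x' - x‖ < ε ∧ ∃ e, ‖CFC.sqrt b - x' * e‖ < ε := by
  obtain ⟨y, hy, d, hxd, hyd⟩ :=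
    exists_mem_factorizations_norm_lt hA ha hb hx hne (ε := ε / 4) (by positivity)
  -- `d` is fixed before `x'` and `e`, so the second tolerance can absorb right multiplication by
  -- `d`.
  set η := ε / 4 / (‖d‖ + 1) with hη
  have hη0 : 0 < η := by positivity
  have hηd : η * ‖d‖ + η = ε / 4 := by rw [hη]; field_simp
  have hηd0 : 0 ≤ η * ‖d‖ := by positivity
  obtain ⟨x', hx', e, hye, hxe⟩ := exists_mem_factorizations_norm_lt hA hb ha hy ⟨x, hx⟩ hη0
  refine ⟨x', hx', ?_, e, by linarith⟩
  have hsa : star x' * x' = star (CFC.sqrt a) * CFC.sqrt a := by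
    rw [hx'.2, (CFC.sqrt_nonneg a).isSelfAdjoint.star_eq, CFC.sqrt_mul_sqrt_self a ha]
  have h1 : ‖x' - x' * (e * d)‖ < ε / 2 := by
    rw [norm_sub_mul_eq_of_star_mul_self_eq hsa]
    have e1 : CFC.sqrt a - CFC.sqrt a * (e * d)
        = (CFC.sqrt a - y * d) + (y - CFC.sqrt a * e) * d := by noncomm_ring
    rw [e1]
    have h2 := norm_add_le (CFC.sqrt a - y * d) ((y - CFC.sqrt a * e) * d)
    have h3 : ‖(y - CFC.sqrt a * e) * d‖ ≤ η * ‖d‖ := (norm_mul_le _ _).trans (by gcongr)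
    linarith
  have e2 : x' - x = (x' - x' * (e * d)) - ((x - CFC.sqrt b * d) + (CFC.sqrt b - x' * e) * d) := by
    noncomm_ring
  have h3 : ‖(CFC.sqrt b - x' * e) * d‖ ≤ η * ‖d‖ := (norm_mul_le _ _).trans (by gcongr)
  rw [e2]
  have h4 := norm_sub_le (x' - x' * (e * d)) ((x - CFC.sqrt b * d) + (CFC.sqrt b - x' * e) * d)
  have h5 := norm_add_le (x - CFC.sqrt b * d) ((CFC.sqrt b - x' * e) * d)
  linarith

/-- If the sets of embeddings in both directions are non-empty, a generic embedding is onto. -/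
theorem exists_mem_factorizations_sqrt_mem (hA : AlmostStableRankOne A) {a b : A} (ha : 0 ≤ a)
    (hb : 0 ≤ b) (hab : (factorizations a b).Nonempty) (hba : (factorizations b a).Nonempty) :
    ∃ x ∈ factorizations a b, CFC.sqrt b ∈ closure {y | ∃ c, y = x * c} := by
  have := (isClosed_factorizations a b).completeSpace_coe
  have := hab.to_subtype
  let U : ℕ → Set (factorizations a b) :=
    fun n => ⋃ c : A, {x | ‖CFC.sqrt b - x * c‖ < 1 / ((n : ℝ) + 1)}
  have hU : Dense (⋂ n, U n) := by
    refine dense_iInter_of_isOpen_nat (fun n => isOpen_iUnion fun c => ?_) fun n => ?_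
    · exact isOpen_lt (by fun_prop) continuous_const
    · refine Metric.dense_iff.2 fun x r hr => ?_
      obtain ⟨x', hx', hd, e, he⟩ := exists_mem_factorizations_norm_sub_lt hA ha hb x.2 hba
        (ε := min r (1 / ((n : ℝ) + 1))) (lt_min hr (by positivity))
      refine ⟨⟨x', hx'⟩, ?_, Set.mem_iUnion.2 ⟨e, he.trans_le (min_le_right _ _)⟩⟩
      rw [Metric.mem_ball, Subtype.dist_eq, dist_eq_norm]
      exact hd.trans_le (min_le_left _ _)
  obtain ⟨x, hx⟩ := hU.nonempty
  refine ⟨x, x.2, Metric.mem_closure_iff.2 fun ε hε => ?_⟩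
  obtain ⟨n, hn⟩ := exists_nat_one_div_lt hε
  obtain ⟨c, hc⟩ := Set.mem_iUnion.1 (Set.mem_iInter.1 hx n)
  exact ⟨x * c, ⟨c, rfl⟩, by rw [dist_eq_norm]; exact lt_trans hc hn⟩

end Factorization

/-! ### From factorizations to Hilbert module maps -/

section Embedding

variable {A : Type*} [NonUnitalCStarAlgebra A] [PartialOrder A] [StarOrderedRing A]

theorem exists_factorization_of_hilbertEmbeds {a b : A} (ha : 0 ≤ a)
    (h : HilbertEmbeds A (closedRightIdeal a) (closedRightIdeal b)) :
    (factorizations a b).Nonempty := by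
  obtain ⟨φ, -, hφ⟩ := h
  let s : closedRightIdeal a := ⟨CFC.sqrt a, sqrt_mem_closedRightIdeal ha⟩
  refine ⟨φ s, (φ s).2, (hφ s s).trans ?_⟩
  change star (CFC.sqrt a) * CFC.sqrt a = a
  rw [(CFC.sqrt_nonneg a).isSelfAdjoint.star_eq, CFC.sqrt_mul_sqrt_self a ha]

/-- An element `x` of `closure (bA)` with `star x * x = a` induces the embedding
`sqrt a * c ↦ x * c`. -/
theorem exists_embedding_of_mem_factorizations {a b x : A} (ha : 0 ≤ a)
    (hx : x ∈ factorizations a b) :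
    ∃ φ : closedRightIdeal a →L[ℂ] closedRightIdeal b,
      (∀ (z : closedRightIdeal a) (c : A), φ (z <• c) = φ z <• c) ∧
      (∀ y z : closedRightIdeal a, star (φ y : A) * φ z = star (y : A) * z) ∧
      ∀ c, ∃ z, (φ z : A) = x * c := by
  have hs := sqrt_mem_closedRightIdeal ha
  have hss : star (CFC.sqrt a) * CFC.sqrt a = a := by
    rw [(CFC.sqrt_nonneg a).isSelfAdjoint.star_eq, CFC.sqrt_mul_sqrt_self a ha]
  let e : A →ₗ[ℂ] closedRightIdeal a := (LinearMap.mulLeft ℂ (CFC.sqrt a)).codRestrict _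
    fun c => mul_mem_closedRightIdeal a hs c
  let f : A →ₗ[ℂ] closedRightIdeal b := (LinearMap.mulLeft ℂ x).codRestrict _
    fun c => mul_mem_closedRightIdeal b hx.1 c
  have hef : ∀ c c', star (f c : A) * f c' = star (e c : A) * e c' := by
    intro c c'
    change star (x * c) * (x * c') = star (CFC.sqrt a * c) * (CFC.sqrt a * c')
    rw [star_mul, star_mul, mul_assoc, mul_assoc, ← mul_assoc (star x), hx.2,
      ← mul_assoc (star (CFC.sqrt a)), hss]
  -- Since `sqrt a * A` is dense in `closure (aA)`, the isometric assignment `e c ↦ f c` extends by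
  -- continuity, and its identities need checking only on the range of `e`.
  have he : DenseRange e := by
    intro z
    rw [Topology.IsInducing.subtypeVal.closure_eq_preimage_closure_image, Set.mem_preimage]
    have h1 : (z : A) ∈ closure {y | ∃ c, y = CFC.sqrt a * c} := by
      rw [← coe_closedRightIdeal, closedRightIdeal_sqrt ha]
      exact z.2
    refine closure_mono ?_ h1
    rintro _ ⟨c, rfl⟩
    exact ⟨e c, ⟨c, rfl⟩, rfl⟩
  have hnorm : ∃ C, ∀ c, ‖f c‖ ≤ C * ‖e c‖ :=
    ⟨1, fun c => by rw [one_mul]; exact (norm_eq_of_star_mul_self_eq (hef c c)).le⟩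
  have := (isClosed_closedRightIdeal b).completeSpace_coe
  let φ : closedRightIdeal a →L[ℂ] closedRightIdeal b := f.extendOfNorm e
  have hφ : ∀ c, φ (e c) = f c := LinearMap.extendOfNorm_eq he hnorm
  refine ⟨φ, fun z c => ?_, fun y z => ?_, fun c => ⟨e c, by rw [hφ]; rfl⟩⟩
  · refine Subtype.ext ?_
    rw [closedRightIdeal.coe_act]
    refine he.induction_on (p := fun z => (φ (z <• c) : A) = φ z * c) z ?_ fun d => ?_
    · have h1 : Continuous fun z : closedRightIdeal a => z <• c :=
        Continuous.subtype_mk (continuous_subtype_val.mul continuous_const) _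
      exact isClosed_eq (by fun_prop) (by fun_prop)
    · have h1 : e d <• c = e (d * c) := Subtype.ext (mul_assoc _ _ _)
      rw [h1, hφ, hφ]
      exact (mul_assoc _ _ _).symm
  · refine he.induction_on₂ (p := fun y z => star (φ y : A) * φ z = star (y : A) * z) ?_ ?_ y z
    · exact isClosed_eq (by fun_prop) (by fun_prop)
    · intro c c'
      rw [hφ, hφ, hef]

theorem hilbertEmbeds_of_mem_factorizations {a b x : A} (ha : 0 ≤ a)
    (hx : x ∈ factorizations a b) : HilbertEmbeds A (closedRightIdeal a) (closedRightIdeal b) := by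
  obtain ⟨φ, h1, h2, -⟩ := exists_embedding_of_mem_factorizations ha hx
  exact ⟨φ, h1, h2⟩

/-- The embedding is isometric on a complete space, so its range is closed. It contains `xA`, hence
`sqrt b`, hence all of `closure (bA)`. -/
theorem hilbertIso_of_mem_factorizations {a b x : A} (ha : 0 ≤ a) (hb : 0 ≤ b)
    (hx : x ∈ factorizations a b) (hbx : CFC.sqrt b ∈ closure {y | ∃ c, y = x * c}) :
    HilbertIso A (closedRightIdeal a) (closedRightIdeal b) := by
  obtain ⟨φ, h1, h2, h3⟩ := exists_embedding_of_mem_factorizations ha hx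
  have hiso : Isometry φ := AddMonoidHomClass.isometry_of_norm φ fun z =>
    norm_eq_of_star_mul_self_eq (h2 z z)
  have := (isClosed_closedRightIdeal a).completeSpace_coe
  have hrange : closedRightIdeal b ≤
      (LinearMap.range φ.toLinearMap).map (closedRightIdeal b).subtype := by
    have hcl : IsClosed
        ((LinearMap.range φ.toLinearMap).map (closedRightIdeal b).subtype : Set A) := by
      have := (isometry_subtype_coe.comp hiso).isClosedEmbedding.isClosed_range
      convert this using 1
      ext z
      simp only [Submodule.map_coe, Set.range_comp]
      rfl
    have hbx' : CFC.sqrt b ∈ closedRightIdeal x := by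
      rw [← SetLike.mem_coe, coe_closedRightIdeal]; exact hbx
    refine (closedRightIdeal_sqrt hb).ge.trans ?_
    refine (closedRightIdeal_le hbx').trans (Submodule.topologicalClosure_minimal _ ?_ hcl)
    rintro _ ⟨c, rfl⟩
    obtain ⟨z, hz⟩ := h3 c
    exact ⟨φ z, ⟨z, rfl⟩, hz⟩
  have hsurj : Function.Surjective φ := by
    intro w
    obtain ⟨_, ⟨z, rfl⟩, hz⟩ := hrange w.2
    exact ⟨z, Subtype.ext hz⟩
  exact ⟨LinearEquiv.ofBijective φ.toLinearMap ⟨hiso.injective, hsurj⟩, h1, h2⟩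

theorem HilbertIso.embeds {a b : A}
    (h : HilbertIso A (closedRightIdeal a) (closedRightIdeal b)) :
    HilbertEmbeds A (closedRightIdeal a) (closedRightIdeal b) ∧
      HilbertEmbeds A (closedRightIdeal b) (closedRightIdeal a) := by
  obtain ⟨φ, h1, h2⟩ := h
  refine ⟨⟨φ.toLinearMap, h1, h2⟩, φ.symm.toLinearMap, fun z c => φ.injective ?_, fun y z => ?_⟩
  · rw [h1]; simp
  · rw [← h2]; simp

end Embedding

theorem proposition3p3 {A : Type*} [NonUnitalCStarAlgebra A] [PartialOrder A] [StarOrderedRing A]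
    (hA : AlmostStableRankOne A) (a b : A) (ha : 0 ≤ a) (hb : 0 ≤ b) :
    (CuntzBelow a b ↔ HilbertEmbeds A (closedRightIdeal a) (closedRightIdeal b)) ∧
    (CuntzEquiv a b ↔ HilbertIso A (closedRightIdeal a) (closedRightIdeal b)) := by
  have below : ∀ {a b : A}, 0 ≤ a → 0 ≤ b →
      HilbertEmbeds A (closedRightIdeal a) (closedRightIdeal b) → CuntzBelow a b :=
    fun ha hb h => by
      obtain ⟨x, hx⟩ := exists_factorization_of_hilbertEmbeds ha h
      exact cuntzBelow_of_mem_factorizations hb hx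
  refine ⟨⟨fun h => ?_, below ha hb⟩, fun h => ?_, fun h =>
    ⟨below ha hb h.embeds.1, below hb ha h.embeds.2⟩⟩
  · obtain ⟨x, hx⟩ := factorizations_nonempty hA hb h
    exact hilbertEmbeds_of_mem_factorizations ha hx
  · obtain ⟨x, hx, hbx⟩ := exists_mem_factorizations_sqrt_mem hA ha hb
      (factorizations_nonempty hA hb h.1) (factorizations_nonempty hA ha h.2)
    exact hilbertIso_of_mem_factorizations ha hb hx hbx
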